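/- Let $K$ be a field of characteristic zero (for example $\mathbb{R}$ or $\mathbb{C}$) and let $0\le d\le n$ be integers. Let $V_{n,d}$ be the space of homogeneous polynomials of degree $d$ in $K[x_1,\dots,x_n]$ (together with $0$) in which every variable occurs with exponent at most one, and let the symmetric group $S_n$ act on it by $\sigma\cdot x_i=x_{\sigma(i)}$. For a partition $\lambda$ of $n$ and a Young tableau $T$ of shape $\lambda$ filled bijectively with $1,\dots,n$, let $R_T$ and $C_T$ be the subgroups of $S_n$ preserving the rows, respectively the columns, of $T$ as sets, and let $Y_T=\bigl(\sum_{c\in C_T}\operatorname{sgn}(c)\,c\bigr)\bigl(\sum_{r\in R_T} r\bigr)\in K[S_n]$. The irreducible representation (irrep) of $S_n$ labeled by $\lambda$ is the left ideal $K[S_n]\,Y_T$ under left multiplication, which up to isomorphism does not depend on $T$. Then $V_{n,d}$ is the direct sum $$V_{n,d}=\bigoplus_{k=0}^{\min(d,\,n-d)} W_k$$ of subrepresentations $W_k$ that are irreducible and pairwise non-isomorphic, where $W_k$ is isomorphic to the irrep labeled by the partition $(n-k,k)$ (for every choice of the tableau $T$ of that shape). Thus $V_{n,d}$ decomposes completely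 into $\min\{d+1,\,n-d+1\}$ irreps, each occurring exactly once, and every irreducible subrepresentation of $V_{n,d}$ is equal to exactly one of the $W_k$. Moreover $$\dim_K W_k=\frac{n!\,(n-2k+1)}{k!\,(n-k+1)!},\qquad \sum_{k=0}^{\min(d,\,n-d)}\dim_K W_k=\binom nd .$$ -/

import Mathlib

open scoped MonoidAlgebra

noncomputable section

/-- The representation of `S_n` on all polynomials in `n` variables: `σ` sends `x_i` to
`x_{σ i}`. -/
def polynomialRep (K : Type*) [Field K] (n : ℕ) :
    Representation K (Equiv.Perm (Fin n)) (MvPolynomial (Fin n) K) where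
  toFun σ := (MvPolynomial.rename (σ : Fin n → Fin n)).toLinearMap
  map_one' := by
    apply LinearMap.ext
    intro p
    exact MvPolynomial.rename_id_apply p
  map_mul' σ τ := by
    apply LinearMap.ext
    intro p
    exact (MvPolynomial.rename_rename (τ : Fin n → Fin n) (σ : Fin n → Fin n) p).symm

/-- Homogeneous multilinear polynomials of degree `d` in `n` variables: homogeneous of degree `d`
(zero included) and of degree at most one in each variable. -/
def multilinearSubrep (K : Type*) [Field K] (n d : ℕ) : Subrepresentation (polynomialRep K n) where
  toSubmodule := MvPolynomial.homogeneousSubmodule (Fin n) K d ⊓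
    MvPolynomial.restrictDegree (Fin n) K 1
  apply_mem_toSubmodule σ p hp := by
    obtain ⟨h1, h2⟩ := Submodule.mem_inf.1 hp
    refine Submodule.mem_inf.2 ⟨?_, ?_⟩
    · exact (MvPolynomial.IsHomogeneous.rename_isHomogeneous
        ((MvPolynomial.mem_homogeneousSubmodule d p).1 h1))
    · rw [MvPolynomial.mem_restrictDegree] at h2 ⊢
      intro s hs i
      obtain ⟨u, rfl, hu⟩ := MvPolynomial.coeff_rename_ne_zero (σ : Fin n → Fin n) p s
        (MvPolynomial.mem_support_iff.1 hs)
      have h := h2 u (MvPolynomial.mem_support_iff.2 hu) (σ.symm i)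
      rw [← Equiv.apply_symm_apply σ i, Finsupp.mapDomain_apply σ.injective]
      simpa using h

/-- The natural permutation representation of `S_n` on the homogeneous multilinear polynomials of
degree `d` in `n` variables. -/
abbrev multilinearRep (K : Type*) [Field K] (n d : ℕ) :
    Representation K (Equiv.Perm (Fin n)) (multilinearSubrep K n d).toSubmodule :=
  (multilinearSubrep K n d).toRepresentation

/-- A Young tableau of shape `μ` with entries `0, …, n - 1`, each occurring exactly once (rows and
columns need not be increasing). A cell is a pair `(row, column)`. -/
abbrev YoungTableau (μ : YoungDiagram) (n : ℕ) : Type := μ.cells ≃ Fin n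

namespace YoungTableau

variable {μ : YoungDiagram} {n : ℕ} (T : YoungTableau μ n)

/-- The row containing the entry `i`. -/
def rowOf (i : Fin n) : ℕ := (T.symm i).1.1

/-- The column containing the entry `i`. -/
def colOf (i : Fin n) : ℕ := (T.symm i).1.2

/-- The permutations preserving the set of entries of each row. -/
def rowGroup : Subgroup (Equiv.Perm (Fin n)) where
  carrier := {σ | ∀ i, rowOf T (σ i) = rowOf T i}
  one_mem' _ := rfl
  mul_mem' {σ τ} hσ hτ i := (hσ (τ i)).trans (hτ i)
  inv_mem' {σ} hσ i := by
    have h := hσ (σ⁻¹ i)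
    rw [← Equiv.Perm.mul_apply, mul_inv_cancel] at h
    exact h.symm

/-- The permutations preserving the set of entries of each column. -/
def colGroup : Subgroup (Equiv.Perm (Fin n)) where
  carrier := {σ | ∀ i, colOf T (σ i) = colOf T i}
  one_mem' _ := rfl
  mul_mem' {σ τ} hσ hτ i := (hσ (τ i)).trans (hτ i)
  inv_mem' {σ} hσ i := by
    have h := hσ (σ⁻¹ i)
    rw [← Equiv.Perm.mul_apply, mul_inv_cancel] at h
    exact h.symm

variable (K : Type*) [Field K]

open Classical in
/-- The row symmetrizer, in the group algebra of `S_n`. -/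
def rowSymmetrizer : K[Equiv.Perm (Fin n)] :=
  ∑ r : Equiv.Perm (Fin n) with r ∈ rowGroup T, MonoidAlgebra.single r 1

open Classical in
/-- The column antisymmetrizer, in the group algebra of `S_n`. -/
def colAntisymmetrizer : K[Equiv.Perm (Fin n)] :=
  ∑ c : Equiv.Perm (Fin n) with c ∈ colGroup T,
    MonoidAlgebra.single c ((Equiv.Perm.sign c : ℤ) : K)

/-- The Young symmetrizer of a tableau. -/
def youngSymmetrizer : K[Equiv.Perm (Fin n)] := colAntisymmetrizer T K * rowSymmetrizer T K

/-- The left ideal `K[S_n] · Y` generated by the Young symmetrizer `Y` of `T`, inside the left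
regular representation. -/
def spechtSubrep : Subrepresentation (Representation.leftRegular K (Equiv.Perm (Fin n))) where
  toSubmodule := LinearMap.range (LinearMap.mulRight K (youngSymmetrizer T K))
  apply_mem_toSubmodule g v hv := by
    obtain ⟨x, rfl⟩ := hv
    refine ⟨MonoidAlgebra.single g 1 * x, ?_⟩
    rw [LinearMap.mulRight_apply, LinearMap.mulRight_apply, mul_assoc,
      ← Representation.asAlgebraHom_ofMulAction_smul_eq_mul,
      Representation.asAlgebraHom_single_one]

/-- The representation of `S_n` on `K[S_n] · Y`. In characteristic zero it is, up to isomorphism,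
the irreducible representation of `S_n` labeled by the partition `μ`. -/
abbrev spechtRep : Representation K (Equiv.Perm (Fin n)) (spechtSubrep T K).toSubmodule :=
  (spechtSubrep T K).toRepresentation

end YoungTableau

/-- The Young diagram of the partition `(a, b)` (which is `(a)` if `b = 0`). -/
def twoRowDiagram (a b : ℕ) (h : b ≤ a) : YoungDiagram :=
  YoungDiagram.ofRowLens [a, b] (by simpa [List.sortedGE_iff_pairwise] using h)

theorem mem_twoRowDiagram {a b : ℕ} (h : b ≤ a) (c : ℕ × ℕ) :
    c ∈ twoRowDiagram a b h ↔ (c.1 = 0 ∧ c.2 < a) ∨ (c.1 = 1 ∧ c.2 < b) := by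
  obtain ⟨i, j⟩ := c
  rw [twoRowDiagram, YoungDiagram.mem_ofRowLens]
  rcases i with _ | _ | i <;> simp

/-- The diagram of `(a, b)` does have tableaux with `a + b` entries. -/
theorem nonempty_tableau_twoRowDiagram {a b n : ℕ} (h : b ≤ a) (hn : a + b = n) :
    Nonempty (YoungTableau (twoRowDiagram a b h) n) := by
  have hc : (twoRowDiagram a b h).cells =
      ({0} ×ˢ Finset.range a) ∪ ({1} ×ˢ Finset.range b) := by
    ext ⟨i, j⟩
    rw [YoungDiagram.mem_cells, mem_twoRowDiagram]
    simp only [Finset.mem_union, Finset.mem_product, Finset.mem_singleton, Finset.mem_range]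
  have hd : Disjoint (({0} : Finset ℕ) ×ˢ Finset.range a) (({1} : Finset ℕ) ×ˢ Finset.range b) :=
    Finset.disjoint_product.2 (Or.inl (by simp))
  refine ⟨Finset.equivFinOfCardEq ?_⟩
  rw [hc, Finset.card_union_of_disjoint hd]
  simpa using hn

theorem index_le_sub {n d : ℕ} (hd : d ≤ n) (k : Fin (min (d + 1) (n - d + 1))) :
    (k : ℕ) ≤ n - (k : ℕ) := by
  have := k.2
  omega

end

/-! Coefficients of squarefree monomials identify $V_{n,d}$ with the functions on $d$-subsets of
$\{1,\dots,n\}$. On functions on all subsets, the operators `up` ($U$) and `down` ($D$) commute with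
$S_n$ and satisfy the $\mathfrak{sl}_2$ relation $DU-UD=n-2k$ on level $k$ (`down_up_apply`). Let
$P_k$ be the kernel of $D$ on level $k$ (`primitive`); then $W_k$ corresponds to $U^{d-k}P_k$.

Decomposition: the relation makes $U^{d-k}$ injective on $P_k$ when $d+k\le n$, and makes $UD$ act
on $U^{d-k}P_k$ by scalars that differ for different $k$, so these spaces are independent.
Rank-nullity for $D$ bounds the dimensions of the $P_k$ from below, so the pieces fill $V_{n,d}$ and
$\dim P_k=\binom nk-\binom n{k-1}$.

Irreducibility: an equivariant endomorphism is a matrix indexed by $d$-sets whose $(A,B)$ entry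
depends only on $|A\setminus B|$, so there are at most $\min(d+1,n-d+1)$ independent ones
(`finrank_intertwiningMap_le`). The projections to the $W_k$ already reach this number, so every
equivariant endomorphism is scalar on each $W_k$. With Maschke's theorem this gives irreducibility,
non-isomorphism and uniqueness.

Label: acting on the indicator of the second row of $T$ embeds $K[S_n]Y_T$ into $P_k$, and $U^{d-k}$
carries it into $W_k$. Irreducibility of $W_k$ makes this embedding onto. -/

open scoped MonoidAlgebra

noncomputable section

/-! ### Invariant complements, projections and irreducible subrepresentations. -/

namespace Subrepresentation

variable {K G V : Type*} [Field K] [Group G] [AddCommGroup V] [Module K V]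
  {ρ : Representation K G V}

theorem isCompl_toSubmodule {p q : Subrepresentation ρ} (h : IsCompl p q) :
    IsCompl p.toSubmodule q.toSubmodule := by
  refine IsCompl.of_eq ?_ ?_
  · rw [← toSubmodule_inf, h.inf_eq_bot]; rfl
  · rw [← toSubmodule_sup, h.sup_eq_top]; rfl

/-- The projection onto an invariant subspace along an invariant complement. -/
def projection (p q : Subrepresentation ρ) (h : IsCompl p.toSubmodule q.toSubmodule) :
    ρ.IntertwiningMap ρ where
  toLinearMap := p.toSubmodule.projection q.toSubmodule h
  isIntertwining' g := by
    ext v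
    obtain ⟨⟨⟨a, ha⟩, ⟨b, hb⟩⟩, rfl⟩ := (Submodule.prodEquivOfIsCompl _ _ h).surjective v
    simp only [Submodule.coe_prodEquivOfIsCompl', LinearMap.comp_apply, map_add]
    rw [Submodule.projection_apply_of_mem_left h ha,
      Submodule.projection_apply_of_mem_left h (p.apply_mem_toSubmodule g ha),
      (Submodule.projection_apply_eq_zero_iff h).2 hb,
      (Submodule.projection_apply_eq_zero_iff h).2 (q.apply_mem_toSubmodule g hb), map_zero]

variable {p q : Subrepresentation ρ} (h : IsCompl p.toSubmodule q.toSubmodule)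

theorem projection_mem (v : V) : p.projection q h v ∈ p.toSubmodule :=
  Submodule.projection_apply_mem h v

theorem projection_of_mem_left {v : V} (hv : v ∈ p.toSubmodule) : p.projection q h v = v :=
  Submodule.projection_apply_of_mem_left h hv

theorem projection_of_mem_right {v : V} (hv : v ∈ q.toSubmodule) : p.projection q h v = 0 :=
  (Submodule.projection_apply_eq_zero_iff h).2 hv

/-- A subrepresentation is irreducible if it is nonzero and every smaller nonzero
subrepresentation equals it. -/
theorem isIrreducible_of_forall_le (W : Subrepresentation ρ) (hW : W.toSubmodule ≠ ⊥)
    (h : ∀ U : Subrepresentation ρ, U.toSubmodule ≤ W.toSubmodule → U.toSubmodule ≠ ⊥ → U = W) :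
    Representation.IsIrreducible (V := W.toSubmodule) W.toRepresentation := by
  have key : ∀ U : Subrepresentation W.toRepresentation, U.toSubmodule = ⊥ ∨ U.toSubmodule = ⊤ := by
    intro U
    let U' : Subrepresentation ρ :=
      { toSubmodule := U.toSubmodule.map W.toSubmodule.subtype
        apply_mem_toSubmodule := by
          rintro g _ ⟨u, hu, rfl⟩
          exact ⟨_, U.apply_mem_toSubmodule g hu, rfl⟩ }
    by_cases hU : U.toSubmodule = ⊥
    · exact Or.inl hU
    · right
      have h1 : U'.toSubmodule ≠ ⊥ := by
        intro h0
        exact hU (Submodule.map_injective_of_injective W.toSubmodule.injective_subtype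
          (h0.trans (Submodule.map_bot _).symm))
      have h2 := h U' (Submodule.map_subtype_le _ _) h1
      apply Submodule.map_injective_of_injective W.toSubmodule.injective_subtype
      rw [Submodule.map_subtype_top]
      exact congrArg Subrepresentation.toSubmodule h2
  refine { exists_pair_ne := ⟨⊥, ⊤, fun h0 => hW ?_⟩, eq_bot_or_eq_top := fun U => ?_ }
  · have h0' : (⊥ : Submodule K W.toSubmodule) = ⊤ := congrArg Subrepresentation.toSubmodule h0
    rw [Submodule.eq_bot_iff]
    intro x hx
    have : (⟨x, hx⟩ : W.toSubmodule) ∈ (⊥ : Submodule K W.toSubmodule) := h0' ▸ Submodule.mem_top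
    simpa using this
  · exact (key U).imp (fun h => toSubmodule_injective h) (fun h => toSubmodule_injective h)

/-- If a nonzero subrepresentation lies in an irreducible one, the two are equal. -/
theorem eq_of_le_of_isIrreducible {U W : Subrepresentation ρ}
    [hW : Representation.IsIrreducible (V := W.toSubmodule) W.toRepresentation]
    (hU : U.toSubmodule ≠ ⊥) (hUW : U.toSubmodule ≤ W.toSubmodule) : U = W := by
  let U' : Subrepresentation W.toRepresentation :=
    { toSubmodule := U.toSubmodule.comap W.toSubmodule.subtype
      apply_mem_toSubmodule := fun g v hv => U.apply_mem_toSubmodule g hv }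
  rcases hW.eq_bot_or_eq_top U' with h | h
  · refine absurd ((Submodule.eq_bot_iff _).2 fun x hx => ?_) hU
    have : (⟨x, hUW hx⟩ : W.toSubmodule) ∈ (⊥ : Submodule K W.toSubmodule) :=
      (congrArg Subrepresentation.toSubmodule h).le hx
    simpa using this
  · apply toSubmodule_injective
    refine le_antisymm hUW fun x hx => ?_
    have : (⟨x, hx⟩ : W.toSubmodule) ∈ U'.toSubmodule := by
      rw [h]; exact Submodule.mem_top
    exact this

theorem toSubmodule_ne_bot_of_isIrreducible {W : Subrepresentation ρ}
    [hW : Representation.IsIrreducible (V := W.toSubmodule) W.toRepresentation] :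
    W.toSubmodule ≠ ⊥ := by
  intro h
  obtain ⟨x, y, hxy⟩ := hW.exists_pair_ne
  apply hxy
  have : Subsingleton W.toSubmodule := by rw [h]; infer_instance
  exact toSubmodule_injective (Subsingleton.elim _ _)

end Subrepresentation

/-! ### Multiplicity-free decompositions from a bound on the endomorphism algebra. -/

namespace Representation

variable {K G V ι : Type*} [DecidableEq ι] [Field K] [Group G] [AddCommGroup V] [Module K V]
  {ρ : Representation K G V} {W : ι → Subrepresentation ρ}

/-- If a representation is the direct sum of as many nonzero subrepresentations as its space of
equivariant endomorphisms has dimensions, every equivariant endomorphism is scalar on each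
summand. -/
theorem exists_forall_apply_eq_smul [Fintype ι]
    (hint : DirectSum.IsInternal fun i => (W i).toSubmodule)
    (hne : ∀ i, (W i).toSubmodule ≠ ⊥) [Module.Finite K (ρ.IntertwiningMap ρ)]
    (hfin : Module.finrank K (ρ.IntertwiningMap ρ) ≤ Fintype.card ι)
    (E : ρ.IntertwiningMap ρ) :
    ∃ c : ι → K, ∀ i, ∀ w ∈ (W i).toSubmodule, E w = c i • w := by
  obtain ⟨hind, hsup⟩ := (DirectSum.isInternal_submodule_iff_iSupIndep_and_iSup_eq_top _).1 hint
  let C : ι → Subrepresentation ρ := fun i =>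
    { toSubmodule := ⨆ j, ⨆ (_ : j ≠ i), (W j).toSubmodule
      apply_mem_toSubmodule := fun g v hv => by
        have : (⨆ j, ⨆ (_ : j ≠ i), (W j).toSubmodule) ≤
            (⨆ j, ⨆ (_ : j ≠ i), (W j).toSubmodule).comap (ρ g) := by
          refine iSup₂_le fun j hj x hx => ?_
          exact Submodule.mem_iSup_of_mem j
            (Submodule.mem_iSup_of_mem hj ((W j).apply_mem_toSubmodule g hx))
        exact this hv }
  have hC : ∀ i, IsCompl (W i).toSubmodule (C i).toSubmodule := fun i => by
    refine ⟨hind i, codisjoint_iff.2 ?_⟩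
    rw [eq_top_iff, ← hsup]
    refine iSup_le fun j => ?_
    by_cases hj : j = i
    · subst hj; exact le_sup_left
    · exact le_sup_of_le_right (le_iSup₂_of_le j hj le_rfl)
  let P : ι → ρ.IntertwiningMap ρ := fun i => (W i).projection (C i) (hC i)
  have hP : ∀ i, ∀ w ∈ (W i).toSubmodule, P i w = w := fun i w hw =>
    Subrepresentation.projection_of_mem_left _ hw
  have hP0 : ∀ i j, j ≠ i → ∀ w ∈ (W j).toSubmodule, P i w = 0 := fun i j hj w hw =>
    Subrepresentation.projection_of_mem_right _
      (Submodule.mem_iSup_of_mem j (Submodule.mem_iSup_of_mem hj hw))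
  have happ : ∀ (c : ι → K) (j : ι), ∀ w ∈ (W j).toSubmodule, (∑ i, c i • P i) w = c j • w := by
    intro c j w hw
    rw [IntertwiningMap.sum_apply, Finset.sum_eq_single j]
    · rw [IntertwiningMap.smul_apply, hP j w hw]
    · intro i _ hi
      rw [IntertwiningMap.smul_apply, hP0 i j hi.symm w hw, smul_zero]
    · simp
  -- Evaluating a relation on a nonzero vector of each summand isolates one coefficient. Being as
  -- many as the dimension allows, the projections then form a basis of the equivariant
  -- endomorphisms.
  have hli : LinearIndependent K P := by
    rw [Fintype.linearIndependent_iff]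
    intro c hc j
    obtain ⟨w, hw, hw0⟩ := Submodule.exists_mem_ne_zero_of_ne_bot (hne j)
    have := happ c j w hw
    rw [hc] at this
    exact (smul_eq_zero.1 this.symm).resolve_right hw0
  have hspan := hli.span_eq_top_of_card_eq_finrank'
    (le_antisymm hli.fintype_card_le_finrank hfin)
  obtain ⟨c, hc⟩ := (Submodule.mem_span_range_iff_exists_fun K).1
    (hspan ▸ Submodule.mem_top : E ∈ Submodule.span K (Set.range P))
  exact ⟨c, fun i w hw => hc ▸ happ c i w hw⟩

section

variable (hint : DirectSum.IsInternal fun i => (W i).toSubmodule)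
  (hscal : ∀ E : ρ.IntertwiningMap ρ, ∃ c : ι → K, ∀ i, ∀ w ∈ (W i).toSubmodule, E w = c i • w)

include hint hscal

/-- If equivariant endomorphisms are scalar on the summands of a direct sum decomposition of a
semisimple representation, every nonzero subrepresentation contains a summand. -/
theorem exists_le_of_ne_bot [IsSemisimpleRepresentation ρ]
    {U : Subrepresentation ρ} (hU : U.toSubmodule ≠ ⊥) :
    ∃ i, (W i).toSubmodule ≤ U.toSubmodule := by
  obtain ⟨U', hU'⟩ := exists_isCompl U
  have hcompl := Subrepresentation.isCompl_toSubmodule hU'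
  -- The projection onto `U` is scalar on each summand: a nonzero scalar puts that summand inside
  -- `U`, and if all scalars vanish the projection is zero, hence so is `U`.
  obtain ⟨c, hc⟩ := hscal (U.projection U' hcompl)
  by_cases h : ∀ i, c i = 0
  · refine absurd ((Submodule.eq_bot_iff _).2 fun u hu => ?_) hU
    have hsup := hint.submodule_iSup_eq_top
    have : (⊤ : Submodule K V) ≤ LinearMap.ker (U.projection U' hcompl).toLinearMap := by
      rw [← hsup]
      refine iSup_le fun i w hw => ?_
      have := hc i w hw
      rw [h i, zero_smul] at this
      exact this
    have h0 : U.projection U' hcompl u = 0 := this (Submodule.mem_top (x := u))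
    rwa [Subrepresentation.projection_of_mem_left hcompl hu] at h0
  · push Not at h
    obtain ⟨i, hi⟩ := h
    refine ⟨i, fun w hw => ?_⟩
    have := Subrepresentation.projection_mem hcompl w
    rw [hc i w hw] at this
    exact (U.toSubmodule.smul_mem_iff hi).1 this

/-- A nonzero invariant `U` inside `W i` contains some `W j`; independence of the summands forces `j
= i`. -/
theorem isIrreducible_summand [IsSemisimpleRepresentation ρ] (hne : ∀ i, (W i).toSubmodule ≠ ⊥)
    (i : ι) : IsIrreducible (V := (W i).toSubmodule) (W i).toRepresentation := by
  refine Subrepresentation.isIrreducible_of_forall_le _ (hne i) fun U hUW hU => ?_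
  obtain ⟨j, hj⟩ := exists_le_of_ne_bot hint hscal hU
  by_cases hij : j = i
  · subst hij
    exact Subrepresentation.toSubmodule_injective (le_antisymm hUW hj)
  · refine absurd ?_ (hne j)
    exact ((hint.submodule_iSupIndep.pairwiseDisjoint hij).eq_bot_of_le (hj.trans hUW))

theorem existsUnique_eq_of_isIrreducible [IsSemisimpleRepresentation ρ]
    (hne : ∀ i, (W i).toSubmodule ≠ ⊥) (U : Subrepresentation ρ)
    (hU : IsIrreducible (V := U.toSubmodule) U.toRepresentation) : ∃! i, U = W i := by
  obtain ⟨i, hi⟩ := exists_le_of_ne_bot hint hscal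
    (Subrepresentation.toSubmodule_ne_bot_of_isIrreducible (W := U))
  have h1 := Subrepresentation.eq_of_le_of_isIrreducible (hne i) hi
  refine ⟨i, h1.symm, fun j hj => ?_⟩
  by_contra hij
  have hd := hint.submodule_iSupIndep.pairwiseDisjoint hij
  simp only [Function.onFun, ← hj, h1] at hd
  exact Subrepresentation.toSubmodule_ne_bot_of_isIrreducible (W := U) (disjoint_self.1 hd)

/-- Extended by zero on a complement of `W i`, an isomorphism would be an endomorphism that is
scalar on `W i` and yet maps it into `W j`, which meets `W i` trivially. -/
theorem isEmpty_equiv_summand [IsSemisimpleRepresentation ρ] (hne : ∀ i, (W i).toSubmodule ≠ ⊥)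
    {i j : ι} (hij : i ≠ j) : IsEmpty ((W i).toRepresentation.Equiv (W j).toRepresentation) := by
  refine ⟨fun φ => ?_⟩
  obtain ⟨C, hC⟩ := exists_isCompl (W i)
  have hcompl := Subrepresentation.isCompl_toSubmodule hC
  let E : ρ.IntertwiningMap ρ :=
    { toLinearMap := (W j).toSubmodule.subtype ∘ₗ φ.toLinearMap ∘ₗ
        (W i).toSubmodule.projectionOnto C.toSubmodule hcompl
      isIntertwining' := fun g => by
        ext v
        have h1 : (W i).toSubmodule.projectionOnto C.toSubmodule hcompl (ρ g v) =
            (W i).toRepresentation g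
              ((W i).toSubmodule.projectionOnto C.toSubmodule hcompl v) :=
          Subtype.ext (IntertwiningMap.isIntertwining _ _ ((W i).projection C hcompl) g v)
        simp only [LinearMap.comp_apply, h1]
        exact congrArg Subtype.val (IntertwiningMap.isIntertwining _ _ φ.toIntertwiningMap g _) }
  obtain ⟨c, hc⟩ := hscal E
  obtain ⟨w, hw, hw0⟩ := Submodule.exists_mem_ne_zero_of_ne_bot (hne i)
  have hEw : E w = (φ ⟨w, hw⟩ : V) := by
    change ((φ ((W i).toSubmodule.projectionOnto C.toSubmodule hcompl w) : _) : V) = _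
    rw [Submodule.projectionOnto_apply_of_mem_left hcompl hw]
  have h1 : (φ ⟨w, hw⟩ : V) ∈ (W i).toSubmodule := by
    rw [← hEw, hc i w hw]
    exact Submodule.smul_mem _ _ hw
  have h2 := Submodule.disjoint_def.1 (hint.submodule_iSupIndep.pairwiseDisjoint hij) _ h1
    (φ ⟨w, hw⟩).2
  have h3 : φ ⟨w, hw⟩ = 0 := Subtype.ext h2
  have h4 : (⟨w, hw⟩ : (W i).toSubmodule) = 0 := by
    have := congrArg φ.symm h3
    simpa using this
  exact hw0 (congrArg Subtype.val h4)

end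

end Representation

/-! ### Raising and lowering operators on functions on finite sets. -/

namespace SetFunction

variable (K α : Type*) [Field K] [Fintype α] [DecidableEq α]

/-- The raising operator: the value at `B` is the sum over the sets obtained from `B` by removing
one element. -/
def up : Module.End K (Finset α → K) where
  toFun f B := ∑ x ∈ B, f (B.erase x)
  map_add' f g := by ext B; simp [Finset.sum_add_distrib]
  map_smul' c f := by ext B; simp [Finset.mul_sum]

/-- The lowering operator: the value at `A` is the sum over the sets obtained from `A` by adding
one element. -/
def down : Module.End K (Finset α → K) where
  toFun f A := ∑ x ∈ Aᶜ, f (insert x A)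
  map_add' f g := by ext B; simp [Finset.sum_add_distrib]
  map_smul' c f := by ext B; simp [Finset.mul_sum]

/-- The functions on sets that are supported on the sets with `k` elements. -/
def layer (k : ℕ) : Submodule K (Finset α → K) where
  carrier := {f | ∀ A, A.card ≠ k → f A = 0}
  add_mem' hf hg A hA := by simp [hf A hA, hg A hA]
  zero_mem' _ _ := rfl
  smul_mem' c f hf A hA := by simp [hf A hA]

/-- The functions supported on the sets with `k` elements that are killed by the lowering
operator. -/
def primitive (k : ℕ) : Submodule K (Finset α → K) := layer K α k ⊓ LinearMap.ker (down K α)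

/-- The permutation representation on functions on sets. -/
def rep : Representation K (Equiv.Perm α) (Finset α → K) where
  toFun σ := LinearMap.funLeft K K (Finset.map σ.symm.toEmbedding)
  map_one' := by
    refine LinearMap.ext fun f => funext fun A => congrArg f ?_
    ext; simp
  map_mul' σ τ := by
    refine LinearMap.ext fun f => funext fun A => congrArg f ?_
    ext; simp

variable {K α}

omit [Fintype α] in
theorem up_apply (f : Finset α → K) (B : Finset α) : up K α f B = ∑ x ∈ B, f (B.erase x) := rfl

theorem down_apply (f : Finset α → K) (A : Finset α) :
    down K α f A = ∑ x ∈ Aᶜ, f (insert x A) := rfl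

omit [Fintype α] [DecidableEq α] in
theorem rep_apply (σ : Equiv.Perm α) (f : Finset α → K) (A : Finset α) :
    rep K α σ f A = f (A.map σ.symm.toEmbedding) := rfl

/-- Adding `x` and removing a different `y` commute. Only the terms returning to `A` differ: `n -
|A|` of them from adding first, `|A|` from removing first. -/
theorem down_up_apply (f : Finset α → K) (A : Finset α) :
    down K α (up K α f) A =
      up K α (down K α f) A + ((Fintype.card α : K) - 2 * (A.card : K)) * f A := by
  have h1 : down K α (up K α f) A =
      ∑ x ∈ Aᶜ, (f A + ∑ y ∈ A, f ((insert x A).erase y)) := by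
    refine Finset.sum_congr rfl fun x hx => ?_
    have hx' : x ∉ A := Finset.mem_compl.1 hx
    rw [up_apply, Finset.sum_insert hx', Finset.erase_insert hx']
  have h2 : up K α (down K α f) A =
      ∑ y ∈ A, (f A + ∑ x ∈ Aᶜ, f ((insert x A).erase y)) := by
    refine Finset.sum_congr rfl fun y hy => ?_
    have hy' : y ∉ Aᶜ := fun h => Finset.mem_compl.1 h hy
    rw [down_apply, Finset.compl_erase, Finset.sum_insert hy', Finset.insert_erase hy]
    refine congrArg _ (Finset.sum_congr rfl fun x hx => ?_)
    have hxy : y ≠ x := fun h => hy' (h ▸ hx)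
    rw [Finset.erase_insert_of_ne hxy.symm]
  have h3 : ((Aᶜ.card : ℕ) : K) = (Fintype.card α : K) - (A.card : K) := by
    rw [Finset.card_compl, Nat.cast_sub (Finset.card_le_univ A)]
  rw [h1, h2, Finset.sum_add_distrib, Finset.sum_add_distrib, Finset.sum_comm (s := A)]
  simp only [Finset.sum_const, nsmul_eq_mul, h3]
  ring

omit [Fintype α] in
theorem up_mem_layer {k : ℕ} {f : Finset α → K} (hf : f ∈ layer K α k) :
    up K α f ∈ layer K α (k + 1) := fun A hA => by
  refine Finset.sum_eq_zero fun x hx => hf _ fun h => hA ?_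
  rw [← h, Finset.card_erase_add_one hx]

omit [Fintype α] in
theorem up_pow_mem_layer {k : ℕ} {f : Finset α → K} (hf : f ∈ layer K α k) (j : ℕ) :
    (up K α ^ j) f ∈ layer K α (k + j) := by
  induction j with
  | zero => simpa using hf
  | succ j ih =>
    rw [pow_succ', Module.End.mul_apply, ← add_assoc]
    exact up_mem_layer ih

theorem down_mem_layer {k : ℕ} {f : Finset α → K} (hf : f ∈ layer K α (k + 1)) :
    down K α f ∈ layer K α k := fun A hA => by
  refine Finset.sum_eq_zero fun x hx => hf _ fun h => hA ?_
  rw [Finset.card_insert_of_notMem (Finset.mem_compl.1 hx)] at h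
  omega

theorem down_eq_zero_of_mem_layer_zero {f : Finset α → K} (hf : f ∈ layer K α 0) :
    down K α f = 0 := by
  ext A
  exact Finset.sum_eq_zero fun x _ => hf _ (by simp)

omit [Fintype α] [DecidableEq α] in
theorem rep_mem_layer (σ : Equiv.Perm α) {k : ℕ} {f : Finset α → K} (hf : f ∈ layer K α k) :
    rep K α σ f ∈ layer K α k := fun A hA => hf _ (by simpa using hA)

omit [Fintype α] in
theorem up_rep (σ : Equiv.Perm α) (f : Finset α → K) :
    up K α (rep K α σ f) = rep K α σ (up K α f) := by
  ext A
  rw [rep_apply, up_apply, up_apply, Finset.sum_map]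
  refine Finset.sum_congr rfl fun x _ => ?_
  rw [rep_apply, Finset.map_erase]

omit [Fintype α] in
theorem up_pow_rep (σ : Equiv.Perm α) (j : ℕ) (f : Finset α → K) :
    (up K α ^ j) (rep K α σ f) = rep K α σ ((up K α ^ j) f) := by
  induction j with
  | zero => rfl
  | succ j ih => rw [pow_succ', Module.End.mul_apply, Module.End.mul_apply, ih, up_rep]

theorem down_rep (σ : Equiv.Perm α) (f : Finset α → K) :
    down K α (rep K α σ f) = rep K α σ (down K α f) := by
  ext A
  have h : (A.map σ.symm.toEmbedding)ᶜ = Aᶜ.map σ.symm.toEmbedding := by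
    ext x; simp
  rw [rep_apply, down_apply, down_apply, h, Finset.sum_map]
  refine Finset.sum_congr rfl fun x _ => ?_
  rw [rep_apply, Finset.map_insert]

theorem rep_mem_primitive (σ : Equiv.Perm α) {k : ℕ} {f : Finset α → K}
    (hf : f ∈ primitive K α k) : rep K α σ f ∈ primitive K α k := by
  refine ⟨rep_mem_layer σ hf.1, ?_⟩
  have : down K α f = 0 := hf.2
  exact (down_rep σ f).trans (by rw [this, map_zero])

/-- Moving `down` past `j + 1` copies of `up` collects the sum of `n - 2(k + i)` over `0 ≤ i ≤ j`,
and the last term dies because `f` is primitive. -/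
theorem down_up_pow {k : ℕ} {f : Finset α → K} (hf : f ∈ primitive K α k) (j : ℕ) :
    down K α ((up K α ^ (j + 1)) f) =
      (((j : K) + 1) * ((Fintype.card α : K) - 2 * k - j)) • (up K α ^ j) f := by
  have hcomm : ∀ (i : ℕ) (g : Finset α → K), g ∈ layer K α i →
      down K α (up K α g) = up K α (down K α g) + ((Fintype.card α : K) - 2 * i) • g := by
    intro i g hg
    ext A
    rw [down_up_apply, Pi.add_apply, Pi.smul_apply, smul_eq_mul]
    by_cases hA : A.card = i
    · rw [hA]
    · rw [hg A hA, mul_zero, mul_zero]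
  have h0 : down K α f = 0 := hf.2
  induction j with
  | zero =>
    rw [zero_add, pow_one, hcomm k f hf.1, h0, map_zero, zero_add, pow_zero]
    simp
  | succ j ih =>
    rw [pow_succ', Module.End.mul_apply, hcomm _ _ (up_pow_mem_layer hf.1 (j + 1)), ih, map_smul,
      ← Module.End.mul_apply, ← pow_succ', ← add_smul]
    congr 1
    push_cast
    ring

/-- Applying `down` undoes one `up` at the cost of a scalar, which is a positive integer as long as
the level reached stays at most `n - k`. -/
theorem up_pow_injOn_primitive [CharZero K] {k : ℕ} (j : ℕ) (hj : 2 * k + j ≤ Fintype.card α)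
    {f : Finset α → K} (hf : f ∈ primitive K α k) (h : (up K α ^ j) f = 0) : f = 0 := by
  induction j with
  | zero => exact h
  | succ j ih =>
    apply ih (by omega)
    have h1 := down_up_pow hf j
    rw [h, map_zero] at h1
    refine (smul_eq_zero.1 h1.symm).resolve_left (mul_ne_zero (Nat.cast_add_one_ne_zero j) ?_)
    have : (Fintype.card α : K) - 2 * k - j = ((Fintype.card α - 2 * k - j : ℕ) : K) := by
      rw [Nat.cast_sub (by omega), Nat.cast_sub (by omega)]
      push_cast
      ring
    rw [this, Nat.cast_ne_zero]
    omega

/-- Functions supported on the sets with `k` elements, as functions on these sets. -/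
def layerEquiv (k : ℕ) : layer K α k ≃ₗ[K] ({A : Finset α // A.card = k} → K) where
  toFun f A := f.1 A.1
  map_add' _ _ := rfl
  map_smul' _ _ := rfl
  invFun g := ⟨fun A => if h : A.card = k then g ⟨A, h⟩ else 0, fun A hA => by simp [hA]⟩
  left_inv f := by
    ext A
    by_cases h : A.card = k
    · simp [h]
    · simp [h, f.2 A h]
  right_inv g := by
    ext A
    simp [A.2]

omit [DecidableEq α] in
theorem finrank_layer (k : ℕ) :
    Module.finrank K (layer K α k) = (Fintype.card α).choose k := by
  rw [(layerEquiv k).finrank_eq, Module.finrank_fintype_fun_eq_card, Fintype.card_finset_len]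

theorem finrank_primitive_zero : Module.finrank K (primitive K α 0) = 1 := by
  have : primitive K α 0 = layer K α 0 :=
    inf_eq_left.2 fun f hf => down_eq_zero_of_mem_layer_zero hf
  rw [this, finrank_layer, Nat.choose_zero_right]

/-- Rank-nullity for `down` between consecutive levels. -/
theorem choose_le_finrank_primitive (k : ℕ) :
    (Fintype.card α).choose (k + 1) ≤
      Module.finrank K (primitive K α (k + 1)) + (Fintype.card α).choose k := by
  let D : layer K α (k + 1) →ₗ[K] layer K α k :=
    (down K α).restrict fun f hf => down_mem_layer hf
  have h1 := D.finrank_range_add_finrank_ker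
  have h2 : Module.finrank K (LinearMap.range D) ≤ (Fintype.card α).choose k := by
    rw [← finrank_layer (K := K)]
    exact Submodule.finrank_le _
  have h3 : Module.finrank K (LinearMap.ker D) ≤ Module.finrank K (primitive K α (k + 1)) := by
    have hm : (LinearMap.ker D).map (layer K α (k + 1)).subtype ≤ primitive K α (k + 1) := by
      rintro _ ⟨f, hf, rfl⟩
      exact ⟨f.2, congrArg Subtype.val hf⟩
    rw [← LinearEquiv.finrank_eq (Submodule.equivMapOfInjective _
      (layer K α (k + 1)).injective_subtype (LinearMap.ker D)).symm]
    exact Submodule.finrank_mono hm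
  rw [finrank_layer] at h1
  omega

variable (K α) in
/-- The copy of the primitive functions of level `k` inside the functions of level `d`. -/
def component (d k : ℕ) : Submodule K (Finset α → K) :=
  (primitive K α k).map (up K α ^ (d - k))

theorem component_le_layer {d k : ℕ} (h : k ≤ d) : component K α d k ≤ layer K α d := by
  rintro _ ⟨f, hf, rfl⟩
  have := up_pow_mem_layer hf.1 (d - k)
  rwa [Nat.add_sub_cancel' h] at this

theorem rep_mem_component (σ : Equiv.Perm α) {d k : ℕ} {f : Finset α → K}
    (hf : f ∈ component K α d k) : rep K α σ f ∈ component K α d k := by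
  obtain ⟨g, hg, rfl⟩ := hf
  exact ⟨rep K α σ g, rep_mem_primitive σ hg, up_pow_rep σ _ g⟩

theorem finrank_component [CharZero K] {d k : ℕ} (hk : k ≤ d) (h : d + k ≤ Fintype.card α) :
    Module.finrank K (component K α d k) = Module.finrank K (primitive K α k) := by
  have hinj : Function.Injective ((up K α ^ (d - k)).domRestrict (primitive K α k)) := by
    rw [← LinearMap.ker_eq_bot, LinearMap.ker_eq_bot']
    rintro ⟨f, hf⟩ h0
    exact Subtype.ext (up_pow_injOn_primitive (d - k) (by omega) hf h0)
  rw [component, ← LinearMap.range_domRestrict]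
  exact LinearMap.finrank_range_of_inj hinj

/-- `down_up_pow` with `d - k - 1` in place of `j`; for `d = k` both sides vanish. -/
theorem component_le_eigenspace {d k : ℕ} (hk : k ≤ d) :
    component K α d k ≤ Module.End.eigenspace (up K α * down K α)
      (((d : K) - k) * ((Fintype.card α : K) - d - k + 1)) := by
  rintro _ ⟨f, hf, rfl⟩
  rw [Module.End.mem_eigenspace_iff]
  obtain ⟨j, rfl⟩ := Nat.exists_eq_add_of_le hk
  rw [Nat.add_sub_cancel_left]
  cases j with
  | zero =>
    have h0 : down K α f = 0 := hf.2
    simp [h0]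
  | succ j =>
    rw [Module.End.mul_apply, down_up_pow hf, map_smul, ← Module.End.mul_apply, ← pow_succ']
    congr 1
    push_cast
    ring

theorem iSupIndep_component [CharZero K] {d m : ℕ} (hm : ∀ k, k < m → k ≤ d ∧ d + k ≤ Fintype.card α) :
    iSupIndep fun k : Fin m => component K α d k := by
  have h := (Module.End.eigenspaces_iSupIndep (up K α * down K α)).comp
    (f := fun k : Fin m => ((d : K) - (k : ℕ)) * ((Fintype.card α : K) - d - (k : ℕ) + 1)) ?_
  · exact h.mono fun k => component_le_eigenspace (hm k k.2).1
  · have key : ∀ k l : Fin m, (k : ℕ) < l →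
        ((d : K) - (k : ℕ)) * ((Fintype.card α : K) - d - (k : ℕ) + 1) ≠
        ((d : K) - (l : ℕ)) * ((Fintype.card α : K) - d - (l : ℕ) + 1) := by
      intro k l hkl heq
      obtain ⟨a, ha⟩ := Nat.exists_eq_add_of_le (hm l l.2).1
      obtain ⟨b, hb⟩ := Nat.exists_eq_add_of_le (hm l l.2).2
      obtain ⟨c, hc⟩ := Nat.exists_eq_add_of_lt hkl
      have hcK : (((l : ℕ) : K)) = ((k : ℕ) : K) + c + 1 := by rw [hc]; push_cast; ring
      rw [hb, ha] at heq
      -- The two eigenvalues differ by `(l - k)(n - k - l + 1)`, written here through the slacks `a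
      -- = d - l`, `b = n - d - l`, `c = l - k - 1` so that it is visibly a positive integer.
      have h0 : (((c + 1) * (a + b + c + 2) : ℕ) : K) = 0 := by
        push_cast at heq ⊢
        rw [hcK] at heq
        linear_combination heq
      rw [Nat.cast_eq_zero] at h0
      simp at h0
    intro k l hkl
    by_contra hne
    rcases lt_or_gt_of_ne (fun h => hne (Fin.ext h) : (k : ℕ) ≠ l) with h | h
    · exact key k l h hkl
    · exact key l k h hkl.symm

end SetFunction

/-! ### Independent families of subspaces, and orbits on pairs of sets. -/

theorem iSupIndep.finrank_iSup {K V ι : Type*} [Field K] [AddCommGroup V] [Module K V]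
    [FiniteDimensional K V] [Fintype ι] {p : ι → Submodule K V} (h : iSupIndep p) :
    Module.finrank K (⨆ i, p i : Submodule K V) = ∑ i, Module.finrank K (p i) := by
  classical
  have h1 := h.dfinsupp_lsum_injective
  rw [Submodule.iSup_eq_range_dfinsupp_lsum, LinearMap.finrank_range_of_inj h1]
  exact Module.finrank_directSum (R := K) (fun i => p i)

theorem iSupIndep.comap_of_injective {K V V' ι : Type*} [Field K] [AddCommGroup V] [Module K V]
    [AddCommGroup V'] [Module K V'] {p : ι → Submodule K V'} (h : iSupIndep p) {f : V →ₗ[K] V'}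
    (hf : Function.Injective f) : iSupIndep fun i => (p i).comap f := by
  intro i
  rw [disjoint_iff, eq_bot_iff]
  intro v hv
  have h2 : (⨆ j, ⨆ (_ : j ≠ i), (p j).comap f) ≤ (⨆ j, ⨆ (_ : j ≠ i), p j).comap f :=
    iSup₂_le fun j hj => Submodule.comap_mono (le_iSup₂_of_le j hj le_rfl)
  have h3 : f v = 0 := Submodule.disjoint_def.1 (h i) _ hv.1 (h2 hv.2)
  exact (Submodule.mem_bot K).2 (hf (h3.trans (map_zero f).symm))

/-- Two pairs of finite sets with equal cardinalities of the sets and of the first differences are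
related by a permutation. -/
theorem exists_perm_map_eq_and_map_eq {α : Type*} [Fintype α] [DecidableEq α]
    {A B A' B' : Finset α} (hA : A.card = A'.card) (hB : B.card = B'.card)
    (hAB : (A \ B).card = (A' \ B').card) :
    ∃ σ : Equiv.Perm α, A.map σ.toEmbedding = A' ∧ B.map σ.toEmbedding = B' := by
  -- Membership in the two sets cuts `α` into four cells whose sizes depend only on `|S|`, `|T|` and
  -- `|S \ T|`; bijections between matching cells glue to the permutation.
  let c : Finset α → Finset α → α → Bool × Bool := fun S T x => (decide (x ∈ S), decide (x ∈ T))
  have hfib : ∀ S T : Finset α, ∀ p : Bool × Bool, Fintype.card {x // c S T x = p} =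
      match p with
      | (true, true) => S.card - (S \ T).card
      | (true, false) => (S \ T).card
      | (false, true) => T.card - (S.card - (S \ T).card)
      | (false, false) => Fintype.card α - (T.card + (S \ T).card) := by
    intro S T p
    have hi := Finset.card_inter_add_card_sdiff S T
    have hi' := Finset.card_inter_add_card_sdiff T S
    rw [Finset.inter_comm] at hi'
    rw [Fintype.card_subtype]
    rcases p with ⟨_ | _, _ | _⟩
    · have : (Finset.univ.filter fun x => c S T x = (false, false)) = (T ∪ (S \ T))ᶜ := by
        ext x; simp [c]; tauto
      rw [this, Finset.card_compl, Finset.card_union_of_disjoint Finset.disjoint_sdiff]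
    · have : (Finset.univ.filter fun x => c S T x = (false, true)) = T \ S := by
        ext x; simp [c]; tauto
      rw [this]; dsimp only; omega
    · have : (Finset.univ.filter fun x => c S T x = (true, false)) = S \ T := by
        ext x; simp [c]
      rw [this]
    · have : (Finset.univ.filter fun x => c S T x = (true, true)) = S ∩ T := by
        ext x; simp [c]
      rw [this]; dsimp only; omega
  have hcard : ∀ p : Bool × Bool, Fintype.card {x // c A B x = p} =
      Fintype.card {x // c A' B' x = p} := fun p => by
    rw [hfib, hfib, hA, hB, hAB]
  let σ : Equiv.Perm α := Equiv.ofFiberEquiv fun p => Fintype.equivOfCardEq (hcard p)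
  have hσ : ∀ x, c A' B' (σ x) = c A B x := fun x => Equiv.ofFiberEquiv_map _ x
  refine ⟨σ, ?_, ?_⟩
  · ext y
    have := congrArg Prod.fst (hσ (σ.symm y))
    simp only [c, Equiv.apply_symm_apply, decide_eq_decide] at this
    rw [this, Finset.mem_map_equiv]
  · ext y
    have := congrArg Prod.snd (hσ (σ.symm y))
    simp only [c, Equiv.apply_symm_apply, decide_eq_decide] at this
    rw [this, Finset.mem_map_equiv]

/-! ### Dimensions of the primitive spaces, and the bound on endomorphisms. -/

namespace SetFunction

variable {K α : Type*} [Field K] [Fintype α] [DecidableEq α]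

theorem choose_le_sum_finrank_primitive (j : ℕ) :
    (Fintype.card α).choose j ≤
      ∑ k ∈ Finset.range (j + 1), Module.finrank K (primitive K α k) := by
  induction j with
  | zero => simp [finrank_primitive_zero]
  | succ j ih =>
    rw [Finset.sum_range_succ]
    have := choose_le_finrank_primitive (K := K) (α := α) j
    omega

/-- The components are independent inside level `d`, which gives the inequality opposite to
`choose_le_sum_finrank_primitive`. -/
theorem sum_finrank_component_le [CharZero K] {d m : ℕ}
    (hm : ∀ k, k < m → k ≤ d ∧ d + k ≤ Fintype.card α) :
    ∑ k ∈ Finset.range m, Module.finrank K (primitive K α k) ≤ (Fintype.card α).choose d := by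
  have h1 := (iSupIndep_component (K := K) hm).finrank_iSup
  rw [← finrank_layer (K := K), Finset.sum_range]
  refine le_trans (le_of_eq ?_) (Submodule.finrank_mono
    (iSup_le fun k : Fin m => component_le_layer (K := K) (α := α) (hm k k.2).1))
  rw [h1]
  exact Finset.sum_congr rfl fun k _ => (finrank_component (hm k k.2).1 (hm k k.2).2).symm

theorem sum_finrank_primitive [CharZero K] {j : ℕ} (hj : 2 * j ≤ Fintype.card α) :
    ∑ k ∈ Finset.range (j + 1), Module.finrank K (primitive K α k) =
      (Fintype.card α).choose j :=
  le_antisymm (sum_finrank_component_le fun k hk => by omega) (choose_le_sum_finrank_primitive j)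

theorem sum_finrank_primitive_min [CharZero K] {d : ℕ} (hd : d ≤ Fintype.card α) :
    ∑ k ∈ Finset.range (min (d + 1) (Fintype.card α - d + 1)),
      Module.finrank K (primitive K α k) = (Fintype.card α).choose d := by
  rcases le_total (2 * d) (Fintype.card α) with h | h
  · rw [min_eq_left (by omega), sum_finrank_primitive h]
  · rw [min_eq_right (by omega), sum_finrank_primitive (by omega), Nat.choose_symm hd]

/-- Subtracting consecutive partial sums in `sum_finrank_primitive` leaves a difference of two
adjacent binomial coefficients. -/
theorem finrank_primitive_eq [CharZero K] {k : ℕ} (hk : 2 * k ≤ Fintype.card α) :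
    (Module.finrank K (primitive K α k) : ℚ) =
      ((Fintype.card α).factorial : ℚ) * ((Fintype.card α : ℚ) - 2 * (k : ℚ) + 1) /
        ((k.factorial : ℚ) * ((Fintype.card α - k + 1).factorial : ℚ)) := by
  cases k with
  | zero =>
    rw [finrank_primitive_zero, Nat.sub_zero, Nat.factorial_succ]
    have h1 := Nat.factorial_ne_zero (Fintype.card α)
    have h2 := Nat.cast_add_one_ne_zero (R := ℚ) (Fintype.card α)
    push_cast
    field_simp
    simp
  | succ k =>
    have h1 := sum_finrank_primitive (K := K) hk
    rw [Finset.sum_range_succ, sum_finrank_primitive (by omega)] at h1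
    obtain ⟨N, hN⟩ := Nat.exists_eq_add_of_le (show k + 1 ≤ Fintype.card α by omega)
    rw [hN] at h1 ⊢
    have h2 : (((k + 1 + N).choose (k + 1) : ℕ) : ℚ) =
        ((k + 1 + N).factorial : ℚ) / ((k + 1).factorial * N.factorial) := by
      rw [Nat.cast_choose ℚ (by omega), Nat.add_sub_cancel_left]
    have h3 : (((k + 1 + N).choose k : ℕ) : ℚ) =
        ((k + 1 + N).factorial : ℚ) / (k.factorial * (N + 1).factorial) := by
      rw [Nat.cast_choose ℚ (by omega), show k + 1 + N - k = N + 1 by omega]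
    have h4 : (Module.finrank K (primitive K α (k + 1)) : ℚ) =
        ((k + 1 + N).choose (k + 1) : ℕ) - ((k + 1 + N).choose k : ℕ) := by
      rw [← h1]; push_cast; ring
    rw [h4, h2, h3, show k + 1 + N - (k + 1) + 1 = N + 1 by omega, Nat.factorial_succ k,
      Nat.factorial_succ N]
    have h5 := Nat.factorial_ne_zero k
    have h6 := Nat.factorial_ne_zero N
    have h7 := Nat.cast_add_one_ne_zero (R := ℚ) k
    have h8 := Nat.cast_add_one_ne_zero (R := ℚ) N
    push_cast
    field_simp
    ring

theorem finrank_primitive_ne_zero [CharZero K] {k : ℕ} (hk : 2 * k ≤ Fintype.card α) :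
    Module.finrank K (primitive K α k) ≠ 0 := by
  intro h
  have h1 := finrank_primitive_eq (K := K) hk
  have h2 : (2 * (k : ℚ)) ≤ Fintype.card α := by exact_mod_cast hk
  have h3 : (0 : ℚ) < (Fintype.card α : ℚ) - 2 * (k : ℚ) + 1 := by linarith
  rw [h, Nat.cast_zero] at h1
  have h4 : (0 : ℚ) < ((Fintype.card α).factorial : ℚ) * ((Fintype.card α : ℚ) - 2 * (k : ℚ) + 1) /
        ((k.factorial : ℚ) * ((Fintype.card α - k + 1).factorial : ℚ)) := by
    positivity
  exact h4.ne h1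

omit [Fintype α] in
theorem single_mem_layer (A : Finset α) : (Pi.single A 1 : Finset α → K) ∈ layer K α A.card :=
  fun B hB => by
    rw [Pi.single_apply, if_neg]
    rintro rfl
    exact hB rfl

omit [Fintype α] in
theorem rep_single (σ : Equiv.Perm α) (A : Finset α) :
    rep K α σ (Pi.single A 1) = Pi.single (A.map σ.toEmbedding) 1 := by
  ext B
  rw [rep_apply, Pi.single_apply, Pi.single_apply]
  refine if_congr ⟨?_, ?_⟩ rfl rfl
  · rintro rfl
    ext x; simp
  · rintro rfl
    ext x; simp

section

variable {V : Type*} [AddCommGroup V] [Module K V] {ρ : Representation K (Equiv.Perm α) V}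
  {d : ℕ} {T : V →ₗ[K] (Finset α → K)} (hinj : Function.Injective T)
  (hrange : LinearMap.range T = layer K α d) (hT : ∀ σ v, T (ρ σ v) = rep K α σ (T v))

include hinj hrange hT

/-- A representation isomorphic to the functions on the sets with `d` elements has at most
`min (d + 1) (n - d + 1)` independent equivariant endomorphisms. -/
theorem finrank_intertwiningMap_le :
    Module.Finite K (ρ.IntertwiningMap ρ) ∧
    Module.finrank K (ρ.IntertwiningMap ρ) ≤ min (d + 1) (Fintype.card α - d + 1) := by
  have hb : ∀ A : {A : Finset α // A.card = d}, ∃ v, T v = Pi.single A.1 1 := fun A => by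
    have := single_mem_layer (K := K) A.1
    rw [A.2, ← hrange] at this
    exact this
  choose b hb using hb
  have hρb : ∀ (σ : Equiv.Perm α) (A B : {A : Finset α // A.card = d}),
      A.1.map σ.toEmbedding = B.1 → ρ σ (b A) = b B := fun σ A B h => hinj <| by
    rw [hT, hb, hb, rep_single, h]
  -- Matrix entries of `E` are constant on the orbits of pairs of `d`-sets, and `|A \ B|` determines
  -- the orbit.
  have hentry : ∀ (E : ρ.IntertwiningMap ρ) (A B A' B' : {A : Finset α // A.card = d}),
      (A.1 \ B.1).card = (A'.1 \ B'.1).card → T (E (b A)) B.1 = T (E (b A')) B'.1 := by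
    intro E A B A' B' h
    obtain ⟨σ, h1, h2⟩ := exists_perm_map_eq_and_map_eq (A.2.trans A'.2.symm)
      (B.2.trans B'.2.symm) h
    rw [← hρb σ A A' h1, Representation.IntertwiningMap.isIntertwining, hT, rep_apply, ← h2]
    have h3 : (B.1.map σ.toEmbedding).map σ.symm.toEmbedding = B.1 := by ext x; simp
    rw [h3]
  have hzero : ∀ E : ρ.IntertwiningMap ρ,
      (∀ A B : {A : Finset α // A.card = d}, T (E (b A)) B.1 = 0) → E = 0 := by
    intro E h
    have h1 : ∀ A, E (b A) = 0 := fun A => hinj <| by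
      rw [map_zero]
      ext B
      by_cases hB : B.card = d
      · exact h A ⟨B, hB⟩
      · have : T (E (b A)) ∈ layer K α d := hrange ▸ LinearMap.mem_range_self T _
        exact this B hB
    ext v
    have h2 : v = ∑ A, T v A.1 • b A := hinj <| by
      rw [map_sum]
      ext B
      rw [Finset.sum_apply]
      by_cases hB : B.card = d
      · rw [Finset.sum_eq_single ⟨B, hB⟩]
        · simp [hb]
        · intro A _ hA
          rw [map_smul, hb, Pi.smul_apply, Pi.single_apply, if_neg, smul_zero]
          exact fun h => hA (Subtype.ext h.symm)
        · simp
      · have : T v ∈ layer K α d := hrange ▸ LinearMap.mem_range_self T _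
        rw [this B hB]
        refine (Finset.sum_eq_zero fun A _ => ?_).symm
        rw [map_smul, hb, Pi.smul_apply, Pi.single_apply, if_neg, smul_zero]
        rintro rfl
        exact hB A.2
    change E v = 0
    rw [h2, map_sum]
    exact Finset.sum_eq_zero fun A _ => by rw [map_smul, h1, smul_zero]
  let m := min (d + 1) (Fintype.card α - d + 1)
  classical
  -- One entry is read off for each value of `|A \ B|`. Both `d` and `n - d` bound this value, so
  -- `m` coordinates determine `E`.
  let Φ : ρ.IntertwiningMap ρ →ₗ[K] (Fin m → K) :=
    { toFun := fun E j =>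
        if h : ∃ p : {A : Finset α // A.card = d} × {A : Finset α // A.card = d},
          (p.1.1 \ p.2.1).card = j then T (E (b h.choose.1)) h.choose.2.1 else 0
      map_add' := fun E E' => by
        ext j
        by_cases h : ∃ p : {A : Finset α // A.card = d} × {A : Finset α // A.card = d},
          (p.1.1 \ p.2.1).card = j
        · simp only [dif_pos h, Pi.add_apply, Representation.IntertwiningMap.coe_add, map_add]
        · simp only [dif_neg h, Pi.add_apply, add_zero]
      map_smul' := fun c E => by
        ext j
        by_cases h : ∃ p : {A : Finset α // A.card = d} × {A : Finset α // A.card = d},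
          (p.1.1 \ p.2.1).card = j
        · simp only [dif_pos h, Pi.smul_apply, Representation.IntertwiningMap.coe_smul, map_smul,
            RingHom.id_apply]
        · simp only [dif_neg h, Pi.smul_apply, smul_zero] }
  have hΦ : Function.Injective Φ := by
    rw [← LinearMap.ker_eq_bot, LinearMap.ker_eq_bot']
    intro E hE
    refine hzero E fun A B => ?_
    have h1 : (A.1 \ B.1).card ≤ d := (Finset.card_le_card Finset.sdiff_subset).trans A.2.le
    have h2 : (A.1 \ B.1).card ≤ Fintype.card α - d := by
      have hBc : B.1ᶜ.card = Fintype.card α - d := by rw [Finset.card_compl, B.2]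
      rw [← hBc]
      exact Finset.card_le_card fun x hx => Finset.mem_compl.2 (Finset.mem_sdiff.1 hx).2
    have h3 : (A.1 \ B.1).card < m := lt_min (by omega) (by omega)
    have h4 := congrFun hE ⟨_, h3⟩
    have h5 : ∃ p : {A : Finset α // A.card = d} × {A : Finset α // A.card = d},
          (p.1.1 \ p.2.1).card = (A.1 \ B.1).card := ⟨(A, B), rfl⟩
    have h6 : Φ E ⟨_, h3⟩ = T (E (b h5.choose.1)) h5.choose.2.1 := dif_pos h5
    rw [h6] at h4
    rw [hentry E A B _ _ h5.choose_spec.symm, h4]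
    rfl
  refine ⟨Module.Finite.of_injective Φ hΦ, ?_⟩
  have := LinearMap.finrank_le_finrank_of_injective hΦ
  rwa [Module.finrank_fintype_fun_eq_card, Fintype.card_fin] at this

end

end SetFunction

/-! ### Multilinear polynomials as functions on sets. -/

/-- The exponent vector of the squarefree monomial with variables in `A`. -/
def squarefreeExponent {α : Type*} (A : Finset α) : α →₀ ℕ := ∑ i ∈ A, Finsupp.single i 1

theorem squarefreeExponent_apply {α : Type*} [DecidableEq α] (A : Finset α) (i : α) :
    squarefreeExponent A i = if i ∈ A then 1 else 0 := by
  simp [squarefreeExponent, Finsupp.single_apply]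

theorem squarefreeExponent_injective {α : Type*} :
    Function.Injective (squarefreeExponent : Finset α → α →₀ ℕ) := by
  classical
  intro A B h
  ext i
  have := DFunLike.congr_fun h i
  rw [squarefreeExponent_apply, squarefreeExponent_apply] at this
  by_cases hA : i ∈ A <;> by_cases hB : i ∈ B <;> simp_all

theorem degree_squarefreeExponent {α : Type*} (A : Finset α) :
    (squarefreeExponent A).degree = A.card := by
  simp [squarefreeExponent]

theorem eq_squarefreeExponent {α : Type*} {s : α →₀ ℕ} (hs : ∀ i, s i ≤ 1) :
    s = squarefreeExponent s.support := by
  classical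
  ext i
  rw [squarefreeExponent_apply]
  split_ifs with h
  · have := Finsupp.mem_support_iff.1 h
    have := hs i
    omega
  · exact Finsupp.notMem_support_iff.1 h

theorem squarefreeExponent_eq_mapDomain {α : Type*} (σ : Equiv.Perm α) (A : Finset α) :
    squarefreeExponent A = (squarefreeExponent (A.map σ.symm.toEmbedding)).mapDomain σ := by
  rw [squarefreeExponent, squarefreeExponent, Finset.sum_map, Finsupp.mapDomain_finsetSum]
  simp

/-- The coefficients of the squarefree monomials of a multilinear polynomial. -/
def multilinearCoeff (K : Type*) [Field K] (n d : ℕ) :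
    (multilinearSubrep K n d).toSubmodule →ₗ[K] (Finset (Fin n) → K) where
  toFun p A := MvPolynomial.coeff (squarefreeExponent A) p.1
  map_add' p q := by ext A; simp
  map_smul' c p := by ext A; simp

section

variable {K : Type*} [Field K] {n d : ℕ}

theorem multilinearCoeff_injective : Function.Injective (multilinearCoeff K n d) := by
  rw [← LinearMap.ker_eq_bot, LinearMap.ker_eq_bot']
  rintro ⟨p, hp⟩ h
  apply Subtype.ext
  ext s
  change MvPolynomial.coeff s p = 0
  by_contra hs
  have h2 := (MvPolynomial.mem_restrictDegree _ p 1).1 (Submodule.mem_inf.1 hp).2 s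
    (MvPolynomial.mem_support_iff.2 hs)
  apply hs
  rw [eq_squarefreeExponent h2]
  exact congrFun h s.support

theorem range_multilinearCoeff :
    LinearMap.range (multilinearCoeff K n d) = SetFunction.layer K (Fin n) d := by
  apply le_antisymm
  · rintro _ ⟨⟨p, hp⟩, rfl⟩ A hA
    by_contra h
    have h1 := (MvPolynomial.mem_homogeneousSubmodule d p).1 (Submodule.mem_inf.1 hp).1
    have h2 := h1.coeff_eq_zero (d := squarefreeExponent A)
      (by rwa [degree_squarefreeExponent])
    exact h h2
  · intro f hf
    let p : MvPolynomial (Fin n) K := ∑ A, MvPolynomial.monomial (squarefreeExponent A) (f A)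
    have hp : p ∈ (multilinearSubrep K n d).toSubmodule := by
      refine Submodule.sum_mem _ fun A _ => Submodule.mem_inf.2 ⟨?_, ?_⟩
      · rw [MvPolynomial.mem_homogeneousSubmodule]
        by_cases hA : A.card = d
        · exact MvPolynomial.isHomogeneous_monomial _ (by rw [degree_squarefreeExponent, hA])
        · rw [hf A hA, map_zero]
          exact MvPolynomial.isHomogeneous_zero _ _ _
      · rw [MvPolynomial.mem_restrictDegree]
        intro s hs i
        have := Finset.mem_singleton.1 (MvPolynomial.support_monomial_subset hs)
        rw [this, squarefreeExponent_apply]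
        split_ifs <;> omega
    refine ⟨⟨p, hp⟩, ?_⟩
    ext B
    change MvPolynomial.coeff (squarefreeExponent B) p = f B
    simp only [p, MvPolynomial.coeff_sum, MvPolynomial.coeff_monomial]
    simp [squarefreeExponent_injective.eq_iff]

theorem multilinearCoeff_rep (σ : Equiv.Perm (Fin n)) (p : (multilinearSubrep K n d).toSubmodule) :
    multilinearCoeff K n d (multilinearRep K n d σ p) =
      SetFunction.rep K (Fin n) σ (multilinearCoeff K n d p) := by
  ext A
  change MvPolynomial.coeff (squarefreeExponent A) (MvPolynomial.rename σ p.1) =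
    MvPolynomial.coeff (squarefreeExponent (A.map σ.symm.toEmbedding)) p.1
  rw [squarefreeExponent_eq_mapDomain σ A,
    MvPolynomial.coeff_rename_mapDomain _ σ.injective]

variable (K n d) in
/-- The multilinear polynomials obtained from the primitive ones of degree `k`. -/
def multilinearComponent (k : ℕ) : Subrepresentation (multilinearRep K n d) where
  toSubmodule := (SetFunction.component K (Fin n) d k).comap (multilinearCoeff K n d)
  apply_mem_toSubmodule σ p hp := by
    rw [Submodule.mem_comap, multilinearCoeff_rep]
    exact SetFunction.rep_mem_component σ hp

theorem map_multilinearComponent {k : ℕ} (hk : k ≤ d) :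
    (multilinearComponent K n d k).toSubmodule.map (multilinearCoeff K n d) =
      SetFunction.component K (Fin n) d k := by
  rw [multilinearComponent, Submodule.map_comap_eq, range_multilinearCoeff]
  exact inf_eq_right.2 (SetFunction.component_le_layer hk)

theorem finrank_multilinearComponent [CharZero K] {k : ℕ} (hk : k ≤ d) (h : d + k ≤ n) :
    Module.finrank K (multilinearComponent K n d k).toSubmodule =
      Module.finrank K (SetFunction.primitive K (Fin n) k) := by
  rw [← SetFunction.finrank_component hk (by rwa [Fintype.card_fin]),
    ← map_multilinearComponent hk]
  exact (Submodule.equivMapOfInjective _ multilinearCoeff_injective _).finrank_eq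

instance : FiniteDimensional K (multilinearSubrep K n d).toSubmodule :=
  Module.Finite.of_injective _ (multilinearCoeff_injective (K := K) (n := n) (d := d))

theorem finrank_multilinearSubrep :
    Module.finrank K (multilinearSubrep K n d).toSubmodule = n.choose d := by
  rw [← LinearMap.finrank_range_of_inj (multilinearCoeff_injective (K := K)),
    range_multilinearCoeff, SetFunction.finrank_layer, Fintype.card_fin]

theorem sum_finrank_multilinearComponent [CharZero K] (hd : d ≤ n) :
    ∑ k : Fin (min (d + 1) (n - d + 1)),
      Module.finrank K (multilinearComponent K n d k).toSubmodule = n.choose d := by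
  have h := SetFunction.sum_finrank_primitive_min (K := K) (α := Fin n) (d := d)
    (by rwa [Fintype.card_fin])
  rw [Fintype.card_fin, Finset.sum_range] at h
  rw [← h]
  exact Finset.sum_congr rfl fun k _ => finrank_multilinearComponent (by omega) (by omega)

/-- Independence transfers along the injective coefficient map, and the dimensions add up to that of
the whole space. -/
theorem isInternal_multilinearComponent [CharZero K] (hd : d ≤ n) :
    DirectSum.IsInternal fun k : Fin (min (d + 1) (n - d + 1)) =>
      (multilinearComponent K n d k).toSubmodule := by
  have hind : iSupIndep fun k : Fin (min (d + 1) (n - d + 1)) =>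
      (multilinearComponent K n d k).toSubmodule :=
    (SetFunction.iSupIndep_component (K := K) (α := Fin n) (d := d) fun k hk => by
      rw [Fintype.card_fin]; omega).comap_of_injective multilinearCoeff_injective
  refine DirectSum.isInternal_submodule_of_iSupIndep_of_iSup_eq_top hind ?_
  apply Submodule.eq_top_of_finrank_eq
  rw [hind.finrank_iSup, sum_finrank_multilinearComponent hd, finrank_multilinearSubrep]

end

/-! ### Young symmetrizers and the embedding of two-row Specht modules. -/

namespace YoungTableau

variable {μ : YoungDiagram} {n : ℕ} (T : YoungTableau μ n) (K : Type*) [Field K]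

theorem eq_of_rowOf_eq_of_colOf_eq {i j : Fin n} (hr : rowOf T i = rowOf T j)
    (hc : colOf T i = colOf T j) : i = j :=
  T.symm.injective (Subtype.ext (Prod.ext hr hc))

theorem rowSymmetrizer_mul_self :
    rowSymmetrizer T K * rowSymmetrizer T K =
      (Nat.card (rowGroup T) : K) • rowSymmetrizer T K := by
  classical
  have h : ∀ r ∈ rowGroup T,
      MonoidAlgebra.single r (1 : K) * rowSymmetrizer T K = rowSymmetrizer T K := by
    intro r hr
    rw [rowSymmetrizer, Finset.mul_sum]
    refine Finset.sum_equiv (Equiv.mulLeft r) (fun s => ?_) fun s _ => ?_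
    · simp [(rowGroup T).mul_mem_cancel_left hr]
    · simp [MonoidAlgebra.single_mul_single]
  conv_lhs => lhs; rw [rowSymmetrizer]
  rw [Finset.sum_mul, Finset.sum_congr rfl fun r hr => h r (Finset.mem_filter.1 hr).2, Finset.sum_const,
    Nat.card_eq_fintype_card, Fintype.card_subtype, Nat.cast_smul_eq_nsmul]

theorem colAntisymmetrizer_mul_single {c : Equiv.Perm (Fin n)} (hc : c ∈ colGroup T)
    (hsign : Equiv.Perm.sign c = -1) :
    colAntisymmetrizer T K * MonoidAlgebra.single c 1 = -colAntisymmetrizer T K := by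
  classical
  rw [colAntisymmetrizer, Finset.sum_mul, ← Finset.sum_neg_distrib]
  refine Finset.sum_equiv (Equiv.mulRight c) (fun s => ?_) fun s _ => ?_
  · simp [(colGroup T).mul_mem_cancel_right hc]
  · simp [MonoidAlgebra.single_mul_single, hsign]

theorem swap_mem_colGroup {x y : Fin n} (h : colOf T x = colOf T y) :
    Equiv.swap x y ∈ colGroup T := by
  intro i
  rcases eq_or_ne i x with rfl | hx
  · rw [Equiv.swap_apply_left, h]
  · rcases eq_or_ne i y with rfl | hy
    · rw [Equiv.swap_apply_right, h]
    · rw [Equiv.swap_apply_of_ne_of_ne hx hy]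

theorem eq_one_of_mem_rowGroup_of_mem_colGroup {σ : Equiv.Perm (Fin n)} (hr : σ ∈ rowGroup T)
    (hc : σ ∈ colGroup T) : σ = 1 :=
  Equiv.ext fun i => eq_of_rowOf_eq_of_colOf_eq T (hr i) (hc i)

/-- The column antisymmetrizer kills the vectors fixed by a transposition of two entries of a
column. -/
theorem colAntisymmetrizer_apply_eq_zero [CharZero K] {V : Type*} [AddCommGroup V] [Module K V]
    (ρ : Representation K (Equiv.Perm (Fin n)) V) {x y : Fin n} (hxy : x ≠ y)
    (h : colOf T x = colOf T y) {v : V} (hv : ρ (Equiv.swap x y) v = v) :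
    ρ.asAlgebraHom (colAntisymmetrizer T K) v = 0 := by
  have h1 := congrArg (fun a => ρ.asAlgebraHom a v) (colAntisymmetrizer_mul_single T K
    (swap_mem_colGroup T h) (Equiv.Perm.sign_swap hxy))
  simp only [map_mul, Module.End.mul_apply, Representation.asAlgebraHom_single_one, hv, map_neg,
    LinearMap.neg_apply] at h1
  rw [eq_neg_iff_add_eq_zero, ← two_smul K] at h1
  exact (smul_eq_zero.1 h1).resolve_left two_ne_zero

section TwoRow

variable {a b : ℕ} {hab : b ≤ a} (T : YoungTableau (twoRowDiagram a b hab) n)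

/-- The entries of the second row. -/
def lowerRow : Finset (Fin n) := Finset.univ.filter fun i => rowOf T i = 1

theorem mem_lowerRow {i : Fin n} : i ∈ lowerRow T ↔ rowOf T i = 1 := by
  simp [lowerRow]

theorem row_col_cases (i : Fin n) :
    (rowOf T i = 0 ∧ colOf T i < a) ∨ (rowOf T i = 1 ∧ colOf T i < b) :=
  (mem_twoRowDiagram hab _).1 ((YoungDiagram.mem_cells _).1 (T.symm i).2)

theorem exists_rowOf_eq_colOf_eq {c : ℕ × ℕ} (hc : c ∈ twoRowDiagram a b hab) :
    ∃ i, rowOf T i = c.1 ∧ colOf T i = c.2 :=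
  ⟨T ⟨c, (YoungDiagram.mem_cells _).2 hc⟩, by simp [rowOf], by simp [colOf]⟩

theorem card_lowerRow : (lowerRow T).card = b := by
  refine Eq.trans ?_ (Finset.card_range b)
  refine Finset.card_bij (fun i _ => colOf T i) (fun i hi => ?_) (fun i hi j hj h => ?_)
    fun c hc => ?_
  · rw [mem_lowerRow] at hi
    rcases row_col_cases T i with h | h
    · omega
    · exact Finset.mem_range.2 h.2
  · rw [mem_lowerRow] at hi hj
    exact eq_of_rowOf_eq_of_colOf_eq T (hi.trans hj.symm) h
  · obtain ⟨i, h1, h2⟩ := exists_rowOf_eq_colOf_eq T (c := (1, c))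
      ((mem_twoRowDiagram hab _).2 (Or.inr ⟨rfl, Finset.mem_range.1 hc⟩))
    exact ⟨i, (mem_lowerRow T).2 h1, h2⟩

/-- With only two rows, preserving the second one already preserves the first. -/
theorem mem_rowGroup_iff {σ : Equiv.Perm (Fin n)} :
    σ ∈ rowGroup T ↔ (lowerRow T).map σ.toEmbedding = lowerRow T := by
  constructor
  · intro h
    ext i
    have := h (σ.symm i)
    rw [Equiv.apply_symm_apply] at this
    rw [Finset.mem_map_equiv, mem_lowerRow, mem_lowerRow, this]
  · intro h i
    have h1 : σ i ∈ lowerRow T ↔ i ∈ lowerRow T := by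
      conv_lhs => rw [← h, Finset.mem_map_equiv, Equiv.symm_apply_apply]
    rw [mem_lowerRow, mem_lowerRow] at h1
    rcases row_col_cases T i with h2 | h2 <;> rcases row_col_cases T (σ i) with h3 | h3 <;> omega

/-- The map from the group algebra to functions on sets given by the action on the indicator of
the second row. -/
def orbitMap : K[Equiv.Perm (Fin n)] →ₗ[K] (Finset (Fin n) → K) :=
  (LinearMap.applyₗ (Pi.single (lowerRow T) 1)).comp
    (SetFunction.rep K (Fin n)).asAlgebraHom.toLinearMap

theorem orbitMap_apply (x : K[Equiv.Perm (Fin n)]) :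
    orbitMap K T x = (SetFunction.rep K (Fin n)).asAlgebraHom x (Pi.single (lowerRow T) 1) := rfl

theorem orbitMap_mul (x y : K[Equiv.Perm (Fin n)]) :
    orbitMap K T (x * y) = (SetFunction.rep K (Fin n)).asAlgebraHom x (orbitMap K T y) := by
  rw [orbitMap_apply, orbitMap_apply, map_mul, Module.End.mul_apply]

/-- Summing over the permutations that move the second row to a given set recovers right
multiplication by the row symmetrizer from the orbit map. -/
theorem sum_orbitMap (x : K[Equiv.Perm (Fin n)]) :
    ∑ g : Equiv.Perm (Fin n),
      MonoidAlgebra.single g (orbitMap K T x ((lowerRow T).map g.toEmbedding)) =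
      x * rowSymmetrizer T K := by
  classical
  induction x using MonoidAlgebra.induction_linear with
  | zero => simp
  | add x y hx hy =>
    rw [add_mul, ← hx, ← hy, ← Finset.sum_add_distrib]
    refine Finset.sum_congr rfl fun g _ => ?_
    rw [map_add, Pi.add_apply, MonoidAlgebra.single_add]
  | single h c =>
    rw [rowSymmetrizer, Finset.mul_sum, Finset.sum_filter]
    refine (Fintype.sum_equiv (Equiv.mulLeft h) _ _ fun r => ?_).symm
    -- Thus the `g` that move the second row where `h` does form the coset of `h` modulo the row
    -- group, and the sum over them is `h` times the row symmetrizer.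
    have hmem : (lowerRow T).map (h * r).toEmbedding = (lowerRow T).map h.toEmbedding ↔
        r ∈ rowGroup T := by
      rw [mem_rowGroup_iff]
      have : (lowerRow T).map (h * r).toEmbedding =
          ((lowerRow T).map r.toEmbedding).map h.toEmbedding := by
        rw [Finset.map_map]; rfl
      rw [this, Finset.map_inj]
    rw [orbitMap_apply, Representation.asAlgebraHom_single, LinearMap.smul_apply,
      SetFunction.rep_single, Pi.smul_apply, Pi.single_apply, Equiv.coe_mulLeft]
    by_cases hr : r ∈ rowGroup T
    · rw [if_pos hr, if_pos (hmem.2 hr), MonoidAlgebra.single_mul_single, smul_eq_mul]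
    · rw [if_neg hr, if_neg (fun h => hr (hmem.1 h)), smul_zero, MonoidAlgebra.single_zero]

theorem orbitMap_rowSymmetrizer :
    orbitMap K T (rowSymmetrizer T K) =
      (Nat.card (rowGroup T) : K) • Pi.single (lowerRow T) 1 := by
  classical
  have h : ∀ r ∈ rowGroup T, orbitMap K T (MonoidAlgebra.single r 1) =
      Pi.single (lowerRow T) 1 := by
    intro r hr
    rw [orbitMap_apply, Representation.asAlgebraHom_single_one, SetFunction.rep_single,
      (mem_rowGroup_iff T).1 hr]
  rw [rowSymmetrizer, map_sum,
    Finset.sum_congr rfl fun r hr => h r (Finset.mem_filter.1 hr).2, Finset.sum_const,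
    Nat.card_eq_fintype_card, Fintype.card_subtype, Nat.cast_smul_eq_nsmul]

theorem natCast_card_rowGroup_ne_zero [CharZero K] : (Nat.card (rowGroup T) : K) ≠ 0 :=
  Nat.cast_ne_zero.2 Nat.card_pos.ne'

theorem orbitMap_youngSymmetrizer :
    orbitMap K T (youngSymmetrizer T K) =
      (Nat.card (rowGroup T) : K) • orbitMap K T (colAntisymmetrizer T K) := by
  rw [youngSymmetrizer, orbitMap_mul, orbitMap_rowSymmetrizer, map_smul, ← orbitMap_apply]

/-- Only `c = 1` contributes, since row and column groups intersect trivially. This is what shows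
that the Young symmetrizer is nonzero. -/
theorem orbitMap_colAntisymmetrizer_lowerRow :
    orbitMap K T (colAntisymmetrizer T K) (lowerRow T) = 1 := by
  classical
  rw [colAntisymmetrizer, map_sum, Finset.sum_apply, Finset.sum_eq_single 1]
  · rw [orbitMap_apply, Representation.asAlgebraHom_single]
    simp
  · intro c hc hc1
    rw [orbitMap_apply, Representation.asAlgebraHom_single, LinearMap.smul_apply,
      SetFunction.rep_single, Pi.smul_apply, Pi.single_apply, if_neg, smul_zero]
    intro h
    exact hc1 (eq_one_of_mem_rowGroup_of_mem_colGroup T ((mem_rowGroup_iff T).2 h.symm)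
      (Finset.mem_filter.1 hc).2)
  · intro h
    exact absurd (Finset.mem_filter.2 ⟨Finset.mem_univ _, (colGroup T).one_mem⟩) h

theorem asAlgebraHom_mem {V : Type*} [AddCommGroup V] [Module K V]
    (ρ : Representation K (Equiv.Perm (Fin n)) V) {p : Submodule K V}
    (hp : ∀ g, ∀ v ∈ p, ρ g v ∈ p) (x : K[Equiv.Perm (Fin n)]) {v : V} (hv : v ∈ p) :
    ρ.asAlgebraHom x v ∈ p := by
  induction x using MonoidAlgebra.induction_linear with
  | zero => simp
  | add x y hx hy => rw [map_add]; exact p.add_mem hx hy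
  | single g c =>
    rw [Representation.asAlgebraHom_single]
    exact p.smul_mem c (hp g v hv)

theorem down_asAlgebraHom (x : K[Equiv.Perm (Fin n)]) (f : Finset (Fin n) → K) :
    SetFunction.down K (Fin n) ((SetFunction.rep K (Fin n)).asAlgebraHom x f) =
      (SetFunction.rep K (Fin n)).asAlgebraHom x (SetFunction.down K (Fin n) f) := by
  induction x using MonoidAlgebra.induction_linear with
  | zero => simp
  | add x y hx hy => rw [map_add, LinearMap.add_apply, LinearMap.add_apply, map_add, hx, hy]
  | single g c =>
    rw [Representation.asAlgebraHom_single, LinearMap.smul_apply, LinearMap.smul_apply, map_smul,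
      SetFunction.down_rep]

/-- The polytabloid of a two-row tableau is primitive. -/
theorem orbitMap_colAntisymmetrizer_mem_primitive [CharZero K] :
    orbitMap K T (colAntisymmetrizer T K) ∈ SetFunction.primitive K (Fin n) b := by
  refine ⟨?_, ?_⟩
  · rw [orbitMap_apply]
    refine asAlgebraHom_mem K _ (fun g v hv => SetFunction.rep_mem_layer g hv) _ ?_
    have := SetFunction.single_mem_layer (K := K) (lowerRow T)
    rwa [card_lowerRow] at this
  · change SetFunction.down K (Fin n) _ = 0
    rw [orbitMap_apply, down_asAlgebraHom,
      LinearMap.pi_apply_eq_sum_univ ((SetFunction.rep K (Fin n)).asAlgebraHom _)]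
    refine Finset.sum_eq_zero fun A _ => ?_
    by_cases hA : SetFunction.down K (Fin n) (Pi.single (lowerRow T) 1) A = 0
    · rw [hA, zero_smul]
    · obtain ⟨x, hx, hx0⟩ := Finset.exists_ne_zero_of_sum_ne_zero hA
      have hxA : x ∉ A := Finset.mem_compl.1 hx
      have hins : insert x A = lowerRow T := by
        by_contra h
        exact hx0 (by rw [Pi.single_apply, if_neg h])
      have hxr : rowOf T x = 1 := (mem_lowerRow T).1 (hins ▸ Finset.mem_insert_self x A)
      have hxc : colOf T x < b := by
        rcases row_col_cases T x with h | h
        · omega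
        · exact h.2
      -- `A` is the second row without `x`, and `y` is the entry above `x`. Neither lies in `A`, so
      -- their transposition fixes `A` and the column antisymmetrizer kills its indicator.
      obtain ⟨y, hy1, hy2⟩ := exists_rowOf_eq_colOf_eq T (c := (0, colOf T x))
        ((mem_twoRowDiagram hab _).2 (Or.inl ⟨rfl, hxc.trans_le hab⟩))
      have hxy : x ≠ y := by
        rintro rfl
        simp only at hy1
        omega
      have hyA : y ∉ A := fun h => by
        have := (mem_lowerRow T).1 (hins ▸ Finset.mem_insert_of_mem h)
        simp only at hy1
        omega
      have hsingle : (fun B => if A = B then (1 : K) else 0) = Pi.single A 1 := by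
        ext B
        rw [Pi.single_apply]
        exact if_congr eq_comm rfl rfl
      rw [hsingle, colAntisymmetrizer_apply_eq_zero T K _ hxy hy2.symm, smul_zero]
      rw [SetFunction.rep_single]
      congr 1
      ext i
      rw [Finset.mem_map_equiv, Equiv.symm_swap]
      rcases eq_or_ne i x with rfl | h1
      · rw [Equiv.swap_apply_left]; tauto
      · rcases eq_or_ne i y with rfl | h2
        · rw [Equiv.swap_apply_right]; tauto
        · rw [Equiv.swap_apply_of_ne_of_ne h1 h2]

theorem orbitMap_mem_primitive [CharZero K] {x : K[Equiv.Perm (Fin n)]}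
    (hx : x ∈ (spechtSubrep T K).toSubmodule) :
    orbitMap K T x ∈ SetFunction.primitive K (Fin n) b := by
  obtain ⟨y, rfl⟩ := hx
  rw [LinearMap.mulRight_apply, orbitMap_mul, orbitMap_youngSymmetrizer]
  exact asAlgebraHom_mem K _ (fun g v hv => SetFunction.rep_mem_primitive g hv) _
    (Submodule.smul_mem _ _ (orbitMap_colAntisymmetrizer_mem_primitive K T))

/-- The orbit map determines `x * rowSymmetrizer T K` by `sum_orbitMap`, and on the left ideal this
product is `x` times the order of the row group. -/
theorem eq_zero_of_orbitMap_eq_zero [CharZero K] {x : K[Equiv.Perm (Fin n)]}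
    (hx : x ∈ (spechtSubrep T K).toSubmodule) (h : orbitMap K T x = 0) : x = 0 := by
  obtain ⟨y, rfl⟩ := hx
  have h1 := sum_orbitMap K T (LinearMap.mulRight K (youngSymmetrizer T K) y)
  simp only [h, Pi.zero_apply, MonoidAlgebra.single_zero, Finset.sum_const_zero] at h1
  have h2 : LinearMap.mulRight K (youngSymmetrizer T K) y * rowSymmetrizer T K =
      (Nat.card (rowGroup T) : K) • LinearMap.mulRight K (youngSymmetrizer T K) y := by
    rw [LinearMap.mulRight_apply, youngSymmetrizer, ← mul_assoc, mul_assoc,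
      rowSymmetrizer_mul_self, mul_smul_comm]
  rw [h2] at h1
  exact (smul_eq_zero.1 h1.symm).resolve_left (natCast_card_rowGroup_ne_zero K T)

theorem orbitMap_leftRegular (g : Equiv.Perm (Fin n)) (x : K[Equiv.Perm (Fin n)]) :
    orbitMap K T (Representation.leftRegular K (Equiv.Perm (Fin n)) g x) =
      SetFunction.rep K (Fin n) g (orbitMap K T x) := by
  have : Representation.leftRegular K (Equiv.Perm (Fin n)) g x = MonoidAlgebra.single g 1 * x := by
    rw [← Representation.asAlgebraHom_ofMulAction_smul_eq_mul,
      Representation.asAlgebraHom_single_one]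
  rw [this, orbitMap_mul, Representation.asAlgebraHom_single_one]

theorem youngSymmetrizer_ne_zero [CharZero K] : youngSymmetrizer T K ≠ 0 := by
  intro h
  have h1 := orbitMap_youngSymmetrizer K T
  rw [h, map_zero] at h1
  have h2 := (smul_eq_zero.1 h1.symm).resolve_left (natCast_card_rowGroup_ne_zero K T)
  have h3 := orbitMap_colAntisymmetrizer_lowerRow K T
  rw [h2] at h3
  exact zero_ne_one h3

/-- The Specht module of a two-row shape `(a, k)` embeds into the multilinear polynomials, with
image in the component of level `k`. -/
theorem exists_injective_intertwiningMap [CharZero K] {d : ℕ} (hbd : b ≤ d) (hdb : d + b ≤ n) :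
    ∃ f : (spechtRep T K).IntertwiningMap (multilinearComponent K n d b).toRepresentation,
      Function.Injective f := by
  let Φ : K[Equiv.Perm (Fin n)] →ₗ[K] (Finset (Fin n) → K) :=
    (SetFunction.up K (Fin n) ^ (d - b)).comp (orbitMap K T)
  have hΦ : ∀ x : (spechtSubrep T K).toSubmodule, Φ x.1 ∈ SetFunction.component K (Fin n) d b :=
    fun x => ⟨_, orbitMap_mem_primitive K T x.2, rfl⟩
  have hpre : ∀ x : (spechtSubrep T K).toSubmodule,
      ∃ w : (multilinearComponent K n d b).toSubmodule, multilinearCoeff K n d w.1 = Φ x.1 := by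
    intro x
    have h := hΦ x
    rw [← map_multilinearComponent hbd] at h
    obtain ⟨w, hw, h⟩ := h
    exact ⟨⟨w, hw⟩, h⟩
  -- The chosen preimages are unique because `multilinearCoeff` is injective, so linearity and
  -- equivariance can be checked after applying it.
  choose w hw using hpre
  have hinj : ∀ {u v : (multilinearComponent K n d b).toSubmodule},
      multilinearCoeff K n d u.1 = multilinearCoeff K n d v.1 → u = v :=
    fun h => Subtype.ext (multilinearCoeff_injective h)
  let f : (spechtRep T K).IntertwiningMap (multilinearComponent K n d b).toRepresentation :=
    { toFun := w
      map_add' := fun x y => hinj <| by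
        rw [hw, Submodule.coe_add, map_add, Submodule.coe_add, map_add, hw, hw]
      map_smul' := fun c x => hinj <| by
        rw [hw, RingHom.id_apply, Submodule.coe_smul, map_smul, Submodule.coe_smul, map_smul, hw]
      isIntertwining' := fun g => LinearMap.ext fun x => hinj <| by
        have h1 := multilinearCoeff_rep (K := K) (d := d) g (w x).1
        refine (hw _).trans (Eq.trans ?_ h1.symm)
        rw [hw]
        exact (congrArg _ (orbitMap_leftRegular K T g x.1)).trans
          (SetFunction.up_pow_rep g (d - b) _) }
  refine ⟨f, ?_⟩
  have hker : ∀ x, f x = 0 → x = 0 := by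
    intro x hx
    have h1 : Φ x.1 = 0 := by
      rw [← hw x]
      change multilinearCoeff K n d (f x).1 = 0
      rw [hx]
      exact map_zero _
    have h2 := SetFunction.up_pow_injOn_primitive (d - b) (by rw [Fintype.card_fin]; omega)
      (orbitMap_mem_primitive K T x.2) h1
    exact Subtype.ext (eq_zero_of_orbitMap_eq_zero K T x.2 h2)
  intro x y hxy
  have : f (x - y) = 0 := by rw [map_sub, hxy, sub_self]
  exact sub_eq_zero.1 (hker _ this)

/-- Irreducibility of the target makes the embedding onto or zero, and it is not zero because the
Young symmetrizer is not. -/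
theorem nonempty_equiv_spechtRep [CharZero K] {d : ℕ} (hbd : b ≤ d) (hdb : d + b ≤ n)
    [Representation.IsIrreducible (V := (multilinearComponent K n d b).toSubmodule)
      (multilinearComponent K n d b).toRepresentation] :
    Nonempty ((multilinearComponent K n d b).toRepresentation.Equiv (spechtRep T K)) := by
  obtain ⟨f, hf⟩ := exists_injective_intertwiningMap K T hbd hdb
  rcases Representation.IsIrreducible.surjective_or_eq_zero
    (V := (multilinearComponent K n d b).toSubmodule) (W := (spechtSubrep T K).toSubmodule) f with h | h
  · exact ⟨(f.ofBijective ⟨hf, h⟩).symm⟩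
  · exfalso
    let Y : (spechtSubrep T K).toSubmodule :=
      ⟨youngSymmetrizer T K, 1, by rw [LinearMap.mulRight_apply, one_mul]⟩
    have h0 : Y = 0 := hf (by rw [h]; rfl)
    exact youngSymmetrizer_ne_zero K T (congrArg Subtype.val h0)

end TwoRow

end YoungTableau

end

/-! ### Assembly of the decomposition. -/

theorem mainTheorem1 {K : Type*} [Field K] [CharZero K] (n d : ℕ) (hd : d ≤ n) :
    ∃ W : Fin (min (d + 1) (n - d + 1)) → Subrepresentation (multilinearRep K n d),
      -- the space is the direct sum of the `W k`
      DirectSum.IsInternal (fun k => (W k).toSubmodule) ∧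
      -- each `W k` is irreducible
      (∀ k, Representation.IsIrreducible (V := (W k).toSubmodule) (W k).toRepresentation) ∧
      -- `W k` is the irrep labeled by `(n - k, k)`, whichever tableau is used to build the latter
      (∀ (k : Fin (min (d + 1) (n - d + 1)))
        (T : YoungTableau (twoRowDiagram (n - (k : ℕ)) (k : ℕ) (index_le_sub hd k)) n),
        Nonempty ((W k).toRepresentation.Equiv (YoungTableau.spechtRep T K))) ∧
      -- the `W k` are pairwise non-isomorphic
      (∀ k l, k ≠ l → IsEmpty ((W k).toRepresentation.Equiv (W l).toRepresentation)) ∧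
      -- there are no other irreducible subrepresentations
      (∀ U : Subrepresentation (multilinearRep K n d), Representation.IsIrreducible (V := U.toSubmodule) U.toRepresentation →
        ∃! k, U = W k) ∧
      -- dimensions
      (∀ k, (Module.finrank K (W k).toSubmodule : ℚ) =
        (Nat.factorial n : ℚ) * ((n : ℚ) - 2 * ((k : ℕ) : ℚ) + 1) /
          ((Nat.factorial (k : ℕ) : ℚ) * (Nat.factorial (n - (k : ℕ) + 1) : ℚ))) ∧
      ∑ k, Module.finrank K (W k).toSubmodule = Nat.choose n d := by
  have hint := isInternal_multilinearComponent (K := K) hd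
  have hrank : ∀ k : Fin (min (d + 1) (n - d + 1)),
      Module.finrank K (multilinearComponent K n d k).toSubmodule =
        Module.finrank K (SetFunction.primitive K (Fin n) k) := fun k =>
    finrank_multilinearComponent (by omega) (by omega)
  have hcard : ∀ k : Fin (min (d + 1) (n - d + 1)), 2 * (k : ℕ) ≤ Fintype.card (Fin n) := fun k => by
    rw [Fintype.card_fin]; omega
  have hne : ∀ k : Fin (min (d + 1) (n - d + 1)),
      (multilinearComponent K n d k).toSubmodule ≠ ⊥ := by
    intro k h
    apply SetFunction.finrank_primitive_ne_zero (K := K) (hcard k)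
    rw [← hrank k, h, finrank_bot]
  obtain ⟨hfin, hle⟩ := SetFunction.finrank_intertwiningMap_le (multilinearCoeff_injective (K := K))
    range_multilinearCoeff (multilinearCoeff_rep (n := n) (d := d))
  -- The number of summands equals the upper bound for the dimension of the endomorphism algebra.
  have hscal := Representation.exists_forall_apply_eq_smul hint hne
    (by rwa [Fintype.card_fin] at hle ⊢)
  have hirr := Representation.isIrreducible_summand hint hscal hne
  refine ⟨fun k => multilinearComponent K n d k, hint, hirr, fun k T => ?_,
    fun k l hkl => Representation.isEmpty_equiv_summand hint hscal hne hkl,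
    Representation.existsUnique_eq_of_isIrreducible hint hscal hne, fun k => ?_,
    sum_finrank_multilinearComponent hd⟩
  · have := hirr k
    exact YoungTableau.nonempty_equiv_spechtRep K T (by omega) (by omega)
  · rw [hrank k, SetFunction.finrank_primitive_eq (hcard k), Fintype.card_fin]
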